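/- Let $A$ be an Artin algebra, i.e. an algebra over a commutative Artinian ring $R$ that is finitely generated as an $R$-module. All modules are finitely generated. For a left (resp. right) module $M$ over a ring $S$, let $M^*=\operatorname{Hom}_S(M,S)$, a right (resp. left) $S$-module, and write $f^*$ for the map $g\mapsto g\circ f$ induced on duals by a module map $f$. For a left module $M$ let $\phi_M\colon M\to M^{**}$, $\phi_M(m)(f)=f(m)$, be the canonical map. $M$ is *torsionless* if $\phi_M$ is a monomorphism (equivalently, $M$ is a submodule of a projective module). A left or right $S$-module $M$ is *semi-Gorenstein-projective* if $\operatorname{Ext}^i_S(M,S)=0$ for all $i\ge 1$, where $\operatorname{Ext}$ and $S$ are taken on the same side as $M$; a left module $M$ is *double semi-Gorenstein-projective* if both $M$ and $M^*$ are semi-Gorenstein-projective. Let $\Lambda=T_2(A)=\begin{pmatrix}A&A\\0&A\end{pmatrix}$. A left $\Lambda$-module is given by a triple $\binom XY_\varphi$, where $\varphi\colon Y\to X$ is a map of left $A$-modules; its elements are the columns $\binom xy$ with $x\in X$, $y\in Y$, and $\begin{pmatrix}a&b\\0&d\end{pmatrix}\binom xy=\binom{ax+b\varphi(y)}{dy}$.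 Let $\pi\colon X\to\operatorname{Coker}\varphi$ be the projection, $\pi^*\colon(\operatorname{Coker}\varphi)^*\to X^*$ its dual, $p\colon X^*\to\operatorname{Coker}\pi^*$ the projection, and $\beta\colon\operatorname{Coker}\pi^*\to Y^*$ the unique $A$-map with $\beta p=\varphi^*$. Then, for every left $\Lambda$-module $\binom XY_\varphi$: (1) The map $p^*\colon(\operatorname{Coker}\pi^*)^*\to X^{**}$ is a monomorphism, and there is an isomorphism of left $\Lambda$-modules $$\widetilde h\colon\binom{X^{**}}{(\operatorname{Coker}\pi^*)^*}_{p^*}\longrightarrow\binom XY_\varphi^{**}$$ such that, whenever $f\in\binom XY_\varphi^*$, $g\in(\operatorname{Coker}\varphi)^*$ and $\alpha\in X^*$ satisfy $f\binom xy=\begin{pmatrix}g(\pi(x))&\alpha(x)\\0&\alpha(\varphi(y))\end{pmatrix}$ for all $x\in X$, $y\in Y$, one has $$\widetilde h\binom bc(f)=\begin{pmatrix}b(\pi^*(g))&b(\alpha)\\0&c(p(\alpha))\end{pmatrix}\qquad\text{for all } b\in X^{**},\ c\in(\operatorname{Coker}\pi^*)^*.$$ Taking $\widetilde h$ as the identity,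 the canonical map of $\binom XY_\varphi$ is $\binom{\phi_X}{\beta^*\phi_Y}$; that is, $\phi_{\binom XY_\varphi}\binom xy=\widetilde h\binom{\phi_X(x)}{\beta^*(\phi_Y(y))}$ for all $x\in X$, $y\in Y$. (2) $\binom XY_\varphi$ is torsionless and double semi-Gorenstein-projective if and only if $\varphi$ is a monomorphism, $X$, $Y$ and $\operatorname{Coker}\varphi$ are double semi-Gorenstein-projective, and $X$ and $Y$ are torsionless. (3) $\binom XY_\varphi$ is double semi-Gorenstein-projective with $\phi_{\binom XY_\varphi}$ an epimorphism if and only if $\varphi^*\colon X^*\to Y^*$ is an epimorphism, $X$ and $Y$ are double semi-Gorenstein-projective, $(\operatorname{Coker}\varphi)^*$ is semi-Gorenstein-projective, and $\phi_X$ and $\phi_Y$ are epimorphisms. -/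

import Mathlib

open CategoryTheory MulOpposite

universe u

noncomputable section

namespace T2Modules

section Duality

variable (A : Type u) [Ring A]

/-- The dual `Hom_A(M, A)` of a left `A`-module `M`. Mathlib makes it a right `A`-module, i.e. a
module over `Aᵐᵒᵖ`, by `(f a)(m) = f(m) a`. -/
abbrev LDual (M : Type u) [AddCommGroup M] [Module A M] : Type u := M →ₗ[A] A

/-- The dual `Hom_A(U, A_A)` of a right `A`-module `U`. Mathlib makes it a left `A`-module
by `(a f)(u) = a f(u)`. -/
abbrev RDual (U : Type u) [AddCommGroup U] [Module Aᵐᵒᵖ U] : Type u := U →ₗ[Aᵐᵒᵖ] A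

variable {A}

/-- `f^* : N^* → M^*`, `g ↦ g ∘ f`, for a map `f : M → N` of left modules. -/
def lDualMap {M N : Type u} [AddCommGroup M] [Module A M] [AddCommGroup N] [Module A N]
    (f : M →ₗ[A] N) : LDual A N →ₗ[Aᵐᵒᵖ] LDual A M where
  toFun g := g.comp f
  map_add' _ _ := rfl
  map_smul' _ _ := rfl

/-- `f^* : V^* → U^*`, `g ↦ g ∘ f`, for a map `f : U → V` of right modules. -/
def rDualMap {U V : Type u} [AddCommGroup U] [Module Aᵐᵒᵖ U] [AddCommGroup V] [Module Aᵐᵒᵖ V]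
    (f : U →ₗ[Aᵐᵒᵖ] V) : RDual A V →ₗ[A] RDual A U where
  toFun g := g.comp f
  map_add' _ _ := rfl
  map_smul' _ _ := rfl

variable (A)

/-- The canonical map `φ_M : M → M^{**}`, `φ_M(m)(f) = f(m)`, of a left module `M`. -/
def canon (M : Type u) [AddCommGroup M] [Module A M] : M →ₗ[A] RDual A (LDual A M) where
  toFun m :=
    { toFun := fun f => f m
      map_add' := fun _ _ => rfl
      map_smul' := fun _ _ => rfl }
  map_add' m n := by ext f; exact map_add f m n
  map_smul' a m := by ext f; exact map_smul f a m

/-- `Ext_S^i(M, N) = 0` for all `i ≥ 1`. -/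
def ExtVanishes (S : Type u) [Ring S] (M N : Type u) [AddCommGroup M] [Module S M]
    [AddCommGroup N] [Module S N] : Prop :=
  ∀ i : ℕ, 1 ≤ i → Subsingleton (Abelian.Ext (ModuleCat.of S M) (ModuleCat.of S N) i)

/-- A left `A`-module `M` is semi-Gorenstein-projective if `Ext_A^i(M, A) = 0` for `i ≥ 1`. -/
def SemiGP (M : Type u) [AddCommGroup M] [Module A M] : Prop :=
  ExtVanishes A M A

/-- A right `A`-module `U` is semi-Gorenstein-projective if `Ext^i(U, A_A) = 0` for `i ≥ 1`,
the `Ext` being that of right `A`-modules. -/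
def RSemiGP (U : Type u) [AddCommGroup U] [Module Aᵐᵒᵖ U] : Prop :=
  ExtVanishes Aᵐᵒᵖ U A

/-- A left module `M` is double semi-Gorenstein-projective if both `M` and `M^*` are
semi-Gorenstein-projective. -/
def DoubleSemiGP (M : Type u) [AddCommGroup M] [Module A M] : Prop :=
  SemiGP A M ∧ RSemiGP A (LDual A M)

/-- A left module `M` is torsionless if `φ_M` is a monomorphism. -/
def Torsionless (M : Type u) [AddCommGroup M] [Module A M] : Prop :=
  Function.Injective (canon A M)

end Duality

/-- The ring `T₂(A)` of upper triangular `2 × 2` matrices over `A`. -/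
def T2 (A : Type u) [Ring A] : Subring (Matrix (Fin 2) (Fin 2) A) where
  carrier := {m | m 1 0 = 0}
  mul_mem' {a b} ha hb := by
    simp only [Set.mem_ofPred_eq] at ha hb ⊢
    simp [Matrix.mul_apply, Fin.sum_univ_two, ha, hb]
  one_mem' := by simp
  add_mem' {a b} ha hb := by
    simp only [Set.mem_ofPred_eq] at ha hb ⊢
    simp [ha, hb]
  zero_mem' := by simp
  neg_mem' {a} ha := by
    simp only [Set.mem_ofPred_eq] at ha ⊢
    simp [ha]

section Triples

variable {A : Type u} [Ring A] {X Y : Type u} [AddCommGroup X] [Module A X]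
  [AddCommGroup Y] [Module A Y]

/-- The left `T₂(A)`-module `(X, Y)_φ` of an `A`-map `φ : Y → X`: its elements are the columns
`(x, y)`, and the matrix `(a b; 0 d)` sends `(x, y)` to `(a x + b φ(y), d y)`. -/
def Triple (_φ : Y →ₗ[A] X) : Type u := X × Y

instance (φ : Y →ₗ[A] X) : AddCommGroup (Triple φ) := inferInstanceAs (AddCommGroup (X × Y))

/-- The element `(x, y)` of `(X, Y)_φ`. -/
def Triple.mk (φ : Y →ₗ[A] X) (x : X) (y : Y) : Triple φ := (x, y)

instance (φ : Y →ₗ[A] X) : Module (T2 A) (Triple φ) where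
  smul m z := (m.1 0 0 • z.1 + m.1 0 1 • φ z.2, m.1 1 1 • z.2)
  one_smul z := by
    refine Prod.ext ?_ ?_
    · change (1 : Matrix (Fin 2) (Fin 2) A) 0 0 • z.1
        + (1 : Matrix (Fin 2) (Fin 2) A) 0 1 • φ z.2 = z.1
      simp
    · change (1 : Matrix (Fin 2) (Fin 2) A) 1 1 • z.2 = z.2
      simp
  mul_smul m n z := by
    have hn : n.1 1 0 = 0 := n.2
    have hm : m.1 1 0 = 0 := m.2
    refine Prod.ext ?_ ?_
    · change (m.1 * n.1) 0 0 • z.1 + (m.1 * n.1) 0 1 • φ z.2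
        = m.1 0 0 • (n.1 0 0 • z.1 + n.1 0 1 • φ z.2) + m.1 0 1 • φ (n.1 1 1 • z.2)
      simp [Matrix.mul_apply, Fin.sum_univ_two, hn, add_smul, mul_smul, add_assoc]
    · change (m.1 * n.1) 1 1 • z.2 = m.1 1 1 • n.1 1 1 • z.2
      simp [Matrix.mul_apply, Fin.sum_univ_two, hm, mul_smul]
  smul_zero m := by
    refine Prod.ext ?_ ?_
    · change m.1 0 0 • (0 : X) + m.1 0 1 • φ 0 = 0
      simp
    · change m.1 1 1 • (0 : Y) = 0
      simp
  smul_add m z w := by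
    refine Prod.ext ?_ ?_
    · change m.1 0 0 • (z.1 + w.1) + m.1 0 1 • φ (z.2 + w.2)
        = (m.1 0 0 • z.1 + m.1 0 1 • φ z.2) + (m.1 0 0 • w.1 + m.1 0 1 • φ w.2)
      simp only [smul_add, map_add]
      abel
    · exact smul_add _ z.2 w.2
  add_smul m n z := by
    refine Prod.ext ?_ ?_
    · change (m.1 0 0 + n.1 0 0) • z.1 + (m.1 0 1 + n.1 0 1) • φ z.2
        = (m.1 0 0 • z.1 + m.1 0 1 • φ z.2) + (n.1 0 0 • z.1 + n.1 0 1 • φ z.2)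
      simp only [add_smul]
      abel
    · exact add_smul _ _ z.2
  zero_smul z := by
    refine Prod.ext ?_ ?_
    · change (0 : A) • z.1 + (0 : A) • φ z.2 = 0
      simp
    · exact zero_smul A z.2

/-- `Coker φ`. -/
abbrev Coker (φ : Y →ₗ[A] X) : Type u := X ⧸ LinearMap.range φ

/-- The projection `π : X → Coker φ`. -/
abbrev proj (φ : Y →ₗ[A] X) : X →ₗ[A] Coker φ := (LinearMap.range φ).mkQ

/-- `Coker π^*`, where `π^* : (Coker φ)^* → X^*`; a right `A`-module. -/
abbrev CokerPiStar (φ : Y →ₗ[A] X) : Type u :=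
  LDual A X ⧸ LinearMap.range (lDualMap (proj φ))

/-- The projection `p : X^* → Coker π^*`. -/
abbrev pMap (φ : Y →ₗ[A] X) : LDual A X →ₗ[Aᵐᵒᵖ] CokerPiStar φ :=
  (LinearMap.range (lDualMap (proj φ))).mkQ

/-- The map `β : Coker π^* → Y^*` with `β ∘ p = φ^*`. -/
def beta (φ : Y →ₗ[A] X) : CokerPiStar φ →ₗ[Aᵐᵒᵖ] LDual A Y :=
  (LinearMap.range (lDualMap (proj φ))).liftQ (lDualMap φ) (by
    rintro _ ⟨g, rfl⟩
    ext y
    change g ((LinearMap.range φ).mkQ (φ y)) = 0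
    rw [Submodule.mkQ_apply, (Submodule.Quotient.mk_eq_zero _).2 (LinearMap.mem_range_self φ y),
      map_zero])

end Triples

end T2Modules

end

/-! Everything reduces to vanishing of `Ext` over `T₂(B)` with coefficients in the regular module,
which as a left module is the sum of its columns `(B, B)_id` and `(B, 0)`. For any `N`, maps from a
triple `(X, Y)_φ` to `(N, N)_id` are maps `X → N`, and maps to `(0, N)` are maps `Y → N`. Since
every triple is a quotient of a projective triple `(P ⊕ Q, Q)` with `P` and `Q` projective,
dimension shifting identifies vanishing of `Ext` into these triples with vanishing of `Ext(X, N)`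
and `Ext(Y, N)`. The sequence `0 → (N, 0) → (N, N) → (0, N) → 0` then handles `(N, 0)`: the one new
condition is that every map `Y → N` extends along `φ`. This is
`extVanishes_idTriple_prod_topTriple_iff`.

The dual of `(X, Y)_φ` is the triple of `π^*` over `T₂(Aᵐᵒᵖ) ≃ T₂(A)ᵐᵒᵖ`, so the same criterion
applies to it. When `φ^*` is onto, `0 → (Coker φ)^* → X^* → Y^* → 0` is exact and the resulting
extension condition becomes a condition on `Y^*`; this gives `doubleSemiGP_triple_iff`. Dualizing
once more gives the double dual, with canonical map `(φ_X, β^* φ_Y)`. If `φ^*` is onto then `β` is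
an isomorphism, so injectivity and surjectivity of the canonical map can be tested on `X` and `Y`
separately. -/

namespace T2Modules

/-! ### Vanishing of `Ext` and long exact sequences -/

section ExtLemmas

variable {S : Type u} [Ring S] {K P M N N' : Type u} [AddCommGroup K] [Module S K]
  [AddCommGroup P] [Module S P] [AddCommGroup M] [Module S M] [AddCommGroup N] [Module S N]
  [AddCommGroup N'] [Module S N']

/-- `Ext_S^i(M, N) = 0`. -/
abbrev ExtZero (S : Type u) [Ring S] (M N : Type u) [AddCommGroup M] [Module S M]
    [AddCommGroup N] [Module S N] (i : ℕ) : Prop :=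
  Subsingleton (Abelian.Ext (ModuleCat.of S M) (ModuleCat.of S N) i)

/-- Every linear map `K → N` factors through `f : K → P`. -/
def HomExtends (f : K →ₗ[S] P) (N : Type u) [AddCommGroup N] [Module S N] : Prop :=
  ∀ u : K →ₗ[S] N, ∃ v : P →ₗ[S] N, v.comp f = u

/-- Every linear map `M → N'` lifts along `g : N → N'`. -/
def HomLifts (M : Type u) [AddCommGroup M] [Module S M] (g : N →ₗ[S] N') : Prop :=
  ∀ u : M →ₗ[S] N', ∃ v : M →ₗ[S] N, g.comp v = u

open Abelian

theorem ExtZero.of_retract_right {i : ℕ} (s : N' →ₗ[S] N) (r : N →ₗ[S] N')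
    (hrs : r.comp s = LinearMap.id) (h : ExtZero S M N i) : ExtZero S M N' i := by
  refine subsingleton_of_forall_eq 0 fun x => ?_
  have e : ModuleCat.ofHom s ≫ ModuleCat.ofHom r = 𝟙 (ModuleCat.of S N') := by
    rw [← ModuleCat.ofHom_comp, hrs]; rfl
  have h0 : x.comp (Ext.mk₀ (ModuleCat.ofHom s)) (add_zero i) = 0 := Subsingleton.elim _ _
  rw [← Ext.comp_mk₀_id x, ← e, ← Ext.mk₀_comp_mk₀, ← Ext.comp_assoc_of_second_deg_zero, h0,
    Ext.zero_comp]

theorem ExtZero.of_retract_left {i : ℕ} (s : K →ₗ[S] M) (r : M →ₗ[S] K)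
    (hrs : r.comp s = LinearMap.id) (h : ExtZero S M N i) : ExtZero S K N i := by
  refine subsingleton_of_forall_eq 0 fun x => ?_
  have e : ModuleCat.ofHom s ≫ ModuleCat.ofHom r = 𝟙 (ModuleCat.of S K) := by
    rw [← ModuleCat.ofHom_comp, hrs]; rfl
  have h0 : (Ext.mk₀ (ModuleCat.ofHom r)).comp x (zero_add i) = 0 := Subsingleton.elim _ _
  rw [← Ext.mk₀_id_comp x, ← e, ← Ext.mk₀_comp_mk₀_assoc, h0, Ext.comp_zero]

theorem extVanishes_congr_left (e : K ≃ₗ[S] M) : ExtVanishes S K N ↔ ExtVanishes S M N :=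
  forall₂_congr fun _ _ =>
    ⟨ExtZero.of_retract_left (e.symm : M →ₗ[S] K) (e : K →ₗ[S] M) (by ext; simp),
     ExtZero.of_retract_left (e : K →ₗ[S] M) (e.symm : M →ₗ[S] K) (by ext; simp)⟩

theorem extVanishes_congr_right (e : N ≃ₗ[S] N') : ExtVanishes S M N ↔ ExtVanishes S M N' :=
  forall₂_congr fun _ _ =>
    ⟨ExtZero.of_retract_right (e.symm : N' →ₗ[S] N) (e : N →ₗ[S] N') (by ext; simp),
     ExtZero.of_retract_right (e : N →ₗ[S] N') (e.symm : N' →ₗ[S] N) (by ext; simp)⟩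

/-- The short complex of an exact sequence `0 → K → P → M → 0`. -/
theorem shortExact_of_exact {f : K →ₗ[S] P} {g : P →ₗ[S] M} (hf : Function.Injective f)
    (hg : Function.Surjective g) (hfg : Function.Exact f g) :
    (ModuleCat.shortComplexOfCompEqZero f g hfg.linearMap_comp_eq_zero).ShortExact :=
  ModuleCat.shortComplex_shortExact _ hfg hf hg

section Contravariant

variable {f : K →ₗ[S] P} {g : P →ₗ[S] M} (hf : Function.Injective f)
    (hg : Function.Surjective g) (hfg : Function.Exact f g)
include hf hg hfg

/-- `Hom(P, N) → Hom(K, N) → Ext¹(M, N) → Ext¹(P, N) = 0` is exact. Phrasing the vanishing as an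
extension property lets it be compared across two different rings. -/
theorem extZero_one_iff_homExtends (hP : ExtZero S P N 1) :
    ExtZero S M N 1 ↔ HomExtends f N := by
  have hS := shortExact_of_exact hf hg hfg
  constructor
  · intro h u
    obtain ⟨y, hy⟩ := Ext.contravariant_sequence_exact₁ hS (ModuleCat.of S N)
      (Ext.mk₀ (ModuleCat.ofHom u)) (n₁ := 1) rfl (Subsingleton.elim _ _)
    obtain ⟨v, rfl⟩ := (Ext.mk₀_bijective _ _).2 y
    rw [Ext.mk₀_comp_mk₀] at hy
    refine ⟨v.hom, ?_⟩
    have := (Ext.mk₀_bijective _ _).1 hy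
    exact congrArg ModuleCat.Hom.hom this
  · intro h
    refine subsingleton_of_forall_eq 0 fun x => ?_
    obtain ⟨y, rfl⟩ := Ext.contravariant_sequence_exact₃ hS (ModuleCat.of S N) x
      (Subsingleton.elim _ _) (n₀ := 0) rfl
    obtain ⟨u, rfl⟩ := (Ext.mk₀_bijective _ _).2 y
    obtain ⟨v, hv⟩ := h u.hom
    have hu : u = ModuleCat.ofHom f ≫ ModuleCat.ofHom v := by
      rw [← ModuleCat.ofHom_comp, hv]; rfl
    rw [hu, ← Ext.mk₀_comp_mk₀]
    exact hS.extClass_comp_assoc _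

theorem extZero_succ_iff {i : ℕ} (hP : ExtZero S P N i) (hP' : ExtZero S P N (i + 1)) :
    ExtZero S M N (i + 1) ↔ ExtZero S K N i := by
  have hS := shortExact_of_exact hf hg hfg
  constructor
  · intro h
    refine subsingleton_of_forall_eq 0 fun x => ?_
    obtain ⟨y, rfl⟩ := Ext.contravariant_sequence_exact₁ hS (ModuleCat.of S N) x
      (n₁ := i + 1) (add_comm _ _) (Subsingleton.elim _ _)
    have : y = 0 := Subsingleton.elim _ _
    rw [this, Ext.comp_zero]
  · intro h
    refine subsingleton_of_forall_eq 0 fun x => ?_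
    obtain ⟨y, rfl⟩ := Ext.contravariant_sequence_exact₃ hS (ModuleCat.of S N) x
      (Subsingleton.elim _ _) (n₀ := i) (add_comm _ _)
    have : y = 0 := Subsingleton.elim _ _
    rw [this, Ext.comp_zero]

/-- Serves both `0 → Y → X → Coker φ → 0` and the dual sequence `0 → (Coker φ)^* → X^* → Y^* → 0`.
-/
theorem extVanishes_quotient_iff (hP : ExtVanishes S P N) :
    ExtVanishes S M N ↔ HomExtends f N ∧ ExtVanishes S K N := by
  constructor
  · exact fun h => ⟨(extZero_one_iff_homExtends hf hg hfg (hP 1 le_rfl)).1 (h 1 le_rfl),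
      fun i hi => (extZero_succ_iff hf hg hfg (hP i hi) (hP _ (by lia))).1 (h _ (by lia))⟩
  · rintro ⟨h, h'⟩ (_ | _ | i) hi
    · lia
    · exact (extZero_one_iff_homExtends hf hg hfg (hP 1 le_rfl)).2 h
    · exact (extZero_succ_iff hf hg hfg (hP _ (by lia)) (hP _ (by lia))).2 (h' _ (by lia))

end Contravariant

section Covariant

variable {f : K →ₗ[S] P} {g : P →ₗ[S] M} (hf : Function.Injective f)
    (hg : Function.Surjective g) (hfg : Function.Exact f g)
include hf hg hfg

theorem extVanishes_sub_iff (hP : ExtVanishes S N P) :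
    ExtVanishes S N K ↔ HomLifts N g ∧ ExtVanishes S N M := by
  have hS := shortExact_of_exact hf hg hfg
  constructor
  · intro h
    constructor
    · intro u
      have := h 1 le_rfl
      obtain ⟨y, hy⟩ := Ext.covariant_sequence_exact₃ (ModuleCat.of S N) hS
        (Ext.mk₀ (ModuleCat.ofHom u)) (n₁ := 1) rfl (Subsingleton.elim _ _)
      obtain ⟨v, rfl⟩ := (Ext.mk₀_bijective _ _).2 y
      rw [Ext.mk₀_comp_mk₀] at hy
      exact ⟨v.hom, congrArg ModuleCat.Hom.hom ((Ext.mk₀_bijective _ _).1 hy)⟩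
    · intro i hi
      have := h (i + 1) (by lia)
      have := hP i hi
      refine subsingleton_of_forall_eq 0 fun x => ?_
      obtain ⟨y, rfl⟩ := Ext.covariant_sequence_exact₃ (ModuleCat.of S N) hS
        x (n₁ := i + 1) rfl (Subsingleton.elim _ _)
      have : y = 0 := Subsingleton.elim _ _
      rw [this, Ext.zero_comp]
  · rintro ⟨h, h'⟩ (_ | _ | i) hi
    · lia
    · have := hP 1 le_rfl
      refine subsingleton_of_forall_eq 0 fun x => ?_
      obtain ⟨y, rfl⟩ := Ext.covariant_sequence_exact₁ (ModuleCat.of S N) hS x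
        (Subsingleton.elim _ _) (n₀ := 0) rfl
      obtain ⟨u, rfl⟩ := (Ext.mk₀_bijective _ _).2 y
      obtain ⟨v, hv⟩ := h u.hom
      have hu : u = ModuleCat.ofHom v ≫ ModuleCat.ofHom g := by
        rw [← ModuleCat.ofHom_comp, hv]; rfl
      rw [hu, ← Ext.mk₀_comp_mk₀, Ext.comp_assoc_of_second_deg_zero]
      have h0 := hS.comp_extClass
      dsimp at h0 ⊢
      rw [h0, Ext.comp_zero]
    · have := hP (i + 1 + 1) (by lia)
      have := h' (i + 1) (by lia)
      refine subsingleton_of_forall_eq 0 fun x => ?_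
      obtain ⟨y, rfl⟩ := Ext.covariant_sequence_exact₁ (ModuleCat.of S N) hS x
        (Subsingleton.elim _ _) (n₀ := i + 1) rfl
      have : y = 0 := Subsingleton.elim _ _
      rw [this, Ext.zero_comp]

end Covariant

theorem extVanishes_prod_iff :
    ExtVanishes S M (N × N') ↔ ExtVanishes S M N ∧ ExtVanishes S M N' := by
  constructor
  · exact fun h => ⟨fun i hi => ExtZero.of_retract_right (LinearMap.inl S N N')
      (LinearMap.fst S N N') (by ext; simp) (h i hi), fun i hi => ExtZero.of_retract_right
      (LinearMap.inr S N N') (LinearMap.snd S N N') (by ext; simp) (h i hi)⟩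
  · rintro ⟨h, h'⟩ i hi
    have := h i hi
    have := h' i hi
    have hS := shortExact_of_exact (LinearMap.inl_injective (R := S) (M := N) (M₂ := N'))
      (LinearMap.snd_surjective (R := S) (M := N) (M₂ := N')) Function.Exact.inl_snd
    refine subsingleton_of_forall_eq 0 fun x => ?_
    obtain ⟨y, rfl⟩ := Ext.covariant_sequence_exact₂ (ModuleCat.of S M) hS x
      (Subsingleton.elim _ _)
    have : y = 0 := Subsingleton.elim _ _
    rw [this, Ext.zero_comp]

theorem extVanishes_of_projective [Module.Projective S P] : ExtVanishes S P N := by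
  intro i hi
  obtain ⟨i, rfl⟩ := Nat.exists_eq_add_of_le' hi
  have : Projective (ModuleCat.of S P) := inferInstance
  exact Ext.subsingleton_of_projective _ _ i

end ExtLemmas

/-- Two indexed families of modules, over two rings, that are compatible with taking syzygies have
the same vanishing of `Ext`. -/
theorem extZero_iff_of_syzygies {S B : Type u} [Ring S] [Ring B] {N N' : Type u} [AddCommGroup N]
    [Module S N] [AddCommGroup N'] [Module B N'] {ι : Type*} (M : ι → ModuleCat.{u} S)
    (X : ι → ModuleCat.{u} B)
    (h : ∀ i, ∃ j, ∃ (P : ModuleCat.{u} S) (Q : ModuleCat.{u} B) (f : M j →ₗ[S] P)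
      (g : P →ₗ[S] M i) (f' : X j →ₗ[B] Q) (g' : Q →ₗ[B] X i),
      Module.Projective S P ∧ Module.Projective B Q ∧
      Function.Injective f ∧ Function.Surjective g ∧ Function.Exact f g ∧
      Function.Injective f' ∧ Function.Surjective g' ∧ Function.Exact f' g' ∧
      (HomExtends f N ↔ HomExtends f' N')) (n : ℕ) (hn : 1 ≤ n) (i : ι) :
    ExtZero S (M i) N n ↔ ExtZero B (X i) N' n := by
  -- The index must vary: the syzygy of the `i`-th pair is the `j`-th pair.
  induction n, hn using Nat.le_induction generalizing i with
  | base =>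
    obtain ⟨j, P, Q, f, g, f', g', _, _, hf, hg, hfg, hf', hg', hfg', hh⟩ := h i
    rw [extZero_one_iff_homExtends hf hg hfg (extVanishes_of_projective 1 le_rfl),
      extZero_one_iff_homExtends hf' hg' hfg' (extVanishes_of_projective 1 le_rfl), hh]
  | succ n hn ih =>
    obtain ⟨j, P, Q, f, g, f', g', _, _, hf, hg, hfg, hf', hg', hfg', hh⟩ := h i
    rw [extZero_succ_iff hf hg hfg (extVanishes_of_projective n hn)
        (extVanishes_of_projective _ (by lia)),
      extZero_succ_iff hf' hg' hfg' (extVanishes_of_projective n hn)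
        (extVanishes_of_projective _ (by lia)), ih j]

/-- `Ext` may be computed after transport along a ring isomorphism. -/
theorem extVanishes_iff_of_ringEquiv {S S' : Type u} [Ring S] [Ring S'] (e : S ≃+* S')
    {M N M' N' : Type u} [AddCommGroup M] [Module S M] [AddCommGroup N] [Module S N]
    [AddCommGroup M'] [Module S' M'] [AddCommGroup N'] [Module S' N']
    (f : M ≃+ M') (hf : ∀ s m, f (s • m) = e s • f m)
    (g : N ≃+ N') (hg : ∀ s m, g (s • m) = e s • g m) :
    ExtVanishes S M N ↔ ExtVanishes S' M' N' := by
  let F := (ModuleCat.restrictScalarsEquivalenceOfRingEquiv.{u} e).functor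
  let f' : M ≃ₗ[S] (F.obj (ModuleCat.of S' M')) := { f with map_smul' := hf }
  let g' : N ≃ₗ[S] (F.obj (ModuleCat.of S' N')) := { g with map_smul' := hg }
  rw [extVanishes_congr_left f', extVanishes_congr_right g']
  refine forall₂_congr fun i _ => ?_
  -- Restriction of scalars along `e` is an equivalence, so it preserves projectives and is
  -- bijective on `Ext`.
  exact (Equiv.ofBijective _ (Functor.mapExt_bijective_of_preservesProjectiveObjects F
    (ModuleCat.of S' M') (ModuleCat.of S' N') i)).symm.subsingleton_congr

/-! ### Matrices, triples and their maps -/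

section TripleMaps

variable {B : Type u} [Ring B] {X Y X' Y' X'' Y'' : Type u} [AddCommGroup X] [Module B X]
  [AddCommGroup Y] [Module B Y] [AddCommGroup X'] [Module B X'] [AddCommGroup Y'] [Module B Y']
  [AddCommGroup X''] [Module B X''] [AddCommGroup Y''] [Module B Y'']
  {φ : Y →ₗ[B] X} {φ' : Y' →ₗ[B] X'} {φ'' : Y'' →ₗ[B] X''}

namespace T2

/-- The upper triangular matrix `(a b; 0 d)`. -/
def mk (a b d : B) : T2 B := ⟨!![a, b; 0, d], show !![a, b; 0, d] 1 0 = 0 by simp⟩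

@[simp] theorem mk_zero_zero (a b d : B) : (mk a b d).1 0 0 = a := rfl
@[simp] theorem mk_zero_one (a b d : B) : (mk a b d).1 0 1 = b := rfl
@[simp] theorem mk_one_one (a b d : B) : (mk a b d).1 1 1 = d := rfl

theorem ext_entries {m n : T2 B} (h₀ : m.1 0 0 = n.1 0 0) (h₁ : m.1 0 1 = n.1 0 1)
    (h₂ : m.1 1 1 = n.1 1 1) : m = n := by
  have hm : m.1 1 0 = 0 := m.2
  have hn : n.1 1 0 = 0 := n.2
  refine Subtype.ext (Matrix.ext fun i j => ?_)
  fin_cases i <;> fin_cases j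
  · exact h₀
  · exact h₁
  · exact hm.trans hn.symm
  · exact h₂

theorem mk_mul_mk (a b d a' b' d' : B) :
    mk a b d * mk a' b' d' = mk (a * a') (a * b' + b * d') (d * d') := by
  refine ext_entries ?_ ?_ ?_ <;> simp [mk, Matrix.mul_apply, Fin.sum_univ_two]

theorem mk_add_mk (a b d a' b' d' : B) :
    mk a b d + mk a' b' d' = mk (a + a') (b + b') (d + d') := by
  refine ext_entries ?_ ?_ ?_ <;> simp [mk]

theorem mk_entries (m : T2 B) : mk (m.1 0 0) (m.1 0 1) (m.1 1 1) = m :=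
  ext_entries rfl rfl rfl

variable (B) in
/-- The diagonal embedding of `B` into `T₂(B)`. -/
def diag : B →+* T2 B where
  toFun b := mk b 0 b
  map_one' := by refine ext_entries ?_ ?_ ?_ <;> simp [mk]
  map_zero' := by refine ext_entries ?_ ?_ ?_ <;> simp [mk]
  map_add' a b := by simp [mk_add_mk]
  map_mul' a b := by simp [mk_mul_mk]

end T2

namespace Triple

theorem smul_def (m : T2 B) (z : Triple φ) :
    m • z = mk φ (m.1 0 0 • z.1 + m.1 0 1 • φ z.2) (m.1 1 1 • z.2) := rfl

theorem smul_mk (m : T2 B) (x : X) (y : Y) :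
    m • mk φ x y = mk φ (m.1 0 0 • x + m.1 0 1 • φ y) (m.1 1 1 • y) := rfl

theorem t2mk_smul_mk (a b d : B) (x : X) (y : Y) :
    T2.mk a b d • mk φ x y = mk φ (a • x + b • φ y) (d • y) := rfl

@[simp] theorem fst_mk (x : X) (y : Y) : (mk φ x y).1 = x := rfl
@[simp] theorem snd_mk (x : X) (y : Y) : (mk φ x y).2 = y := rfl
@[simp] theorem fst_add (z w : Triple φ) : (z + w).1 = z.1 + w.1 := rfl
@[simp] theorem snd_add (z w : Triple φ) : (z + w).2 = z.2 + w.2 := rfl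

@[simp] theorem fst_smul (m : T2 B) (z : Triple φ) :
    (m • z).1 = m.1 0 0 • z.1 + m.1 0 1 • φ z.2 := rfl
@[simp] theorem snd_smul (m : T2 B) (z : Triple φ) : (m • z).2 = m.1 1 1 • z.2 := rfl

theorem mk_add_mk (x x' : X) (y y' : Y) :
    mk φ x y + mk φ x' y' = mk φ (x + x') (y + y') := rfl

/-- The map of triples given by a commutative square. -/
def map (a : X →ₗ[B] X') (b : Y →ₗ[B] Y') (h : a.comp φ = φ'.comp b) :
    Triple φ →ₗ[T2 B] Triple φ' where
  toFun z := mk φ' (a z.1) (b z.2)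
  map_add' z w := by simp [mk_add_mk]
  map_smul' m z := by
    have := LinearMap.congr_fun h z.2
    simp only [LinearMap.comp_apply] at this
    simp [smul_mk, this]

theorem square_comp {a : X →ₗ[B] X'} {b : Y →ₗ[B] Y'} (h : a.comp φ = φ'.comp b)
    {a' : X' →ₗ[B] X''} {b' : Y' →ₗ[B] Y''} (h' : a'.comp φ' = φ''.comp b') :
    (a'.comp a).comp φ = φ''.comp (b'.comp b) := by
  rw [LinearMap.comp_assoc, h, ← LinearMap.comp_assoc, h', LinearMap.comp_assoc]

theorem map_comp_map {a : X →ₗ[B] X'} {b : Y →ₗ[B] Y'} (h : a.comp φ = φ'.comp b)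
    {a' : X' →ₗ[B] X''} {b' : Y' →ₗ[B] Y''} (h' : a'.comp φ' = φ''.comp b') :
    (map a' b' h').comp (map a b h) = map (a'.comp a) (b'.comp b) (square_comp h h') := rfl

theorem map_injective {a : X →ₗ[B] X'} {b : Y →ₗ[B] Y'} (h : a.comp φ = φ'.comp b)
    (ha : Function.Injective a) (hb : Function.Injective b) :
    Function.Injective (map a b h) := Prod.map_injective.2 ⟨ha, hb⟩

theorem map_surjective {a : X →ₗ[B] X'} {b : Y →ₗ[B] Y'} (h : a.comp φ = φ'.comp b)
    (ha : Function.Surjective a) (hb : Function.Surjective b) :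
    Function.Surjective (map a b h) := Prod.map_surjective.2 ⟨ha, hb⟩

theorem map_exact {a : X →ₗ[B] X'} {b : Y →ₗ[B] Y'} (h : a.comp φ = φ'.comp b)
    {a' : X' →ₗ[B] X''} {b' : Y' →ₗ[B] Y''} (h' : a'.comp φ' = φ''.comp b')
    (ha : Function.Exact a a') (hb : Function.Exact b b') :
    Function.Exact (map a b h) (map a' b' h') := by
  rintro ⟨x, y⟩
  constructor
  · intro hz
    obtain ⟨hx, hy⟩ := Prod.mk_inj.1 hz
    obtain ⟨x, rfl⟩ := (ha x).1 hx
    obtain ⟨y, rfl⟩ := (hb y).1 hy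
    exact ⟨mk φ x y, rfl⟩
  · rintro ⟨⟨x', y'⟩, hz⟩
    obtain ⟨rfl, rfl⟩ := Prod.mk_inj.1 hz
    exact Prod.ext ((ha _).2 ⟨x', rfl⟩) ((hb _).2 ⟨y', rfl⟩)

theorem apply_mk_smul (u : Triple φ →ₗ[T2 B] Triple φ') (a b d : B) (x : X) (y : Y) :
    u (mk φ (a • x + b • φ y) (d • y)) =
      mk φ' (a • (u (mk φ x y)).1 + b • φ' (u (mk φ x y)).2) (d • (u (mk φ x y)).2) :=
  u.map_smul (T2.mk a b d) (mk φ x y)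

/-- Every map of triples comes from a commutative square. -/
theorem exists_eq_map (u : Triple φ →ₗ[T2 B] Triple φ') :
    ∃ (a : X →ₗ[B] X') (b : Y →ₗ[B] Y') (h : a.comp φ = φ'.comp b), u = map a b h := by
  -- The diagonal matrix units force `u` to respect the two coordinates; the unit `(0 1; 0 0)` gives
  -- the commutative square.
  have hx (x : X) : u (mk φ x 0) = mk φ' (u (mk φ x 0)).1 0 := by
    simpa using apply_mk_smul u 1 0 0 x 0
  have hy (y : Y) : u (mk φ 0 y) = mk φ' 0 (u (mk φ 0 y)).2 := by
    simpa using apply_mk_smul u 0 0 1 0 y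
  let a : X →ₗ[B] X' :=
    { toFun := fun x => (u (mk φ x 0)).1
      map_add' := fun x x' => by rw [← fst_add, ← map_add, mk_add_mk, add_zero]
      map_smul' := fun c x => by
        simpa using congrArg Prod.fst (apply_mk_smul u c 0 0 x 0) }
  let b : Y →ₗ[B] Y' :=
    { toFun := fun y => (u (mk φ 0 y)).2
      map_add' := fun x x' => by rw [← snd_add, ← map_add, mk_add_mk, add_zero]
      map_smul' := fun c y => by
        simpa using congrArg Prod.snd (apply_mk_smul u 0 0 c 0 y) }
  have h : a.comp φ = φ'.comp b := by
    ext y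
    simpa [a, b] using congrArg Prod.fst (apply_mk_smul u 0 1 0 0 y)
  refine ⟨a, b, h, LinearMap.ext fun z => ?_⟩
  obtain ⟨x, y⟩ := z
  have e : mk φ x y = mk φ x 0 + mk φ 0 y := by rw [mk_add_mk, add_zero, zero_add]
  change u (mk φ x y) = mk φ' (u (mk φ x 0)).1 (u (mk φ 0 y)).2
  rw [e, map_add, hx, hy, mk_add_mk, add_zero, zero_add]
  rfl

theorem map_eq_map_iff {a a' : X →ₗ[B] X'} {b b' : Y →ₗ[B] Y'} (h : a.comp φ = φ'.comp b)
    (h' : a'.comp φ = φ'.comp b') : map a b h = map a' b' h' ↔ a = a' ∧ b = b' := by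
  constructor
  · intro e
    exact ⟨LinearMap.ext fun x => congrArg Prod.fst (LinearMap.congr_fun e (mk φ x 0)),
      LinearMap.ext fun y => congrArg Prod.snd (LinearMap.congr_fun e (mk φ 0 y))⟩
  · rintro ⟨rfl, rfl⟩; rfl

end Triple

end TripleMaps

/-! ### Projective triples -/

section Projective

variable {B : Type u} [Ring B]

open Triple in
/-- The triple `(P ⊕ Q, Q)` of the inclusion is projective if `P` and `Q` are. -/
theorem projective_triple_inr (P Q : Type u) [AddCommGroup P] [Module B P]
    [AddCommGroup Q] [Module B Q] [Module.Projective B P] [Module.Projective B Q] :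
    Module.Projective (T2 B) (Triple (LinearMap.inr B P Q)) := by
  refine Module.Projective.of_lifting_property'' fun f hf => ?_
  set M := Triple (LinearMap.inr B P Q) →₀ T2 B
  -- It suffices to split a surjection `f` from a free module. Over `B`, acting diagonally,
  -- projectivity of `P` and `Q` lifts their inclusions through `f`.
  let : Module B M := Module.compHom M (T2.diag B)
  have hB (b : B) (m : M) : b • m = T2.mk b 0 b • m := rfl
  let π : M →ₗ[B] (P × Q) × Q :=
    { toFun := fun m => f m
      map_add' := fun m n => f.map_add m n
      map_smul' := fun b m => by
        rw [hB, map_smul, smul_def]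
        simp [mk, Prod.smul_def]
        rfl }
  obtain ⟨l₀, h₀⟩ := Module.projective_lifting_property π
    (LinearMap.inl B (P × Q) Q ∘ₗ LinearMap.inl B P Q) hf
  obtain ⟨l₁, h₁⟩ := Module.projective_lifting_property π (LinearMap.inr B (P × Q) Q) hf
  have h₀ (v : P) : f (l₀ v) = mk _ (v, 0) 0 := LinearMap.congr_fun h₀ v
  have h₁ (w : Q) : f (l₁ w) = mk _ (0, 0) w := LinearMap.congr_fun h₁ w
  -- Multiplying by matrix units turns the `B`-linear lifts into a `T₂(B)`-linear section. The upper
  -- copy of `Q` is `(0 1; 0 0)` applied to the lower one, so it needs no lift of its own.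
  let s : Triple (LinearMap.inr B P Q) →ₗ[T2 B] M :=
    { toFun := fun z => T2.mk (1 : B) 0 0 • l₀ z.1.1 + T2.mk (0 : B) 1 0 • l₁ z.1.2 +
        T2.mk (0 : B) 0 1 • l₁ z.2
      map_add' := fun z w => by
        simp only [fst_add, snd_add, Prod.fst_add, Prod.snd_add, map_add, smul_add]
        abel
      map_smul' := fun m z => by
        simp only [fst_smul, snd_smul, Prod.fst_add, Prod.snd_add, Prod.smul_fst, Prod.smul_snd,
          LinearMap.inr_apply, smul_zero, add_zero, map_add, map_smul, smul_add, hB, smul_smul,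
          RingHom.id_apply]
        rw [← T2.mk_entries m]
        simp only [T2.mk_mul_mk, T2.mk_zero_zero, T2.mk_zero_one, T2.mk_one_one, mul_zero, zero_mul,
          mul_one, one_mul, add_zero, zero_add]
        rw [add_assoc, add_assoc, add_assoc, ← add_smul, T2.mk_add_mk, add_zero, zero_add,
          add_zero] }
  refine ⟨s, LinearMap.ext fun z => ?_⟩
  change f (_ + _ + _) = z
  obtain ⟨⟨v, w⟩, w'⟩ := z
  simp only [map_add, map_smul, h₀, h₁, t2mk_smul_mk, mk_add_mk]
  simp [mk]
  rfl

end Projective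

/-! ### `Ext` from a triple into `(N, N)`, `(0, N)` and `(N, 0)` -/

section TripleExt

open Triple

variable {B : Type u} [Ring B] {X Y X' Y' N : Type u} [AddCommGroup X] [Module B X]
  [AddCommGroup Y] [Module B Y] [AddCommGroup X'] [Module B X'] [AddCommGroup Y'] [Module B Y']
  [AddCommGroup N] [Module B N]
  {φ : Y →ₗ[B] X} {φ' : Y' →ₗ[B] X'}

variable (B N) in
/-- The triple `(N, N)` of the identity of `N`. -/
abbrev idTriple : Type u := Triple (LinearMap.id : N →ₗ[B] N)

variable (B N) in
/-- The triple `(0, N)`. -/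
abbrev bottomTriple : Type u := Triple (0 : N →ₗ[B] PUnit.{u + 1})

variable (B N) in
/-- The triple `(N, 0)`. -/
abbrev topTriple : Type u := Triple (0 : PUnit.{u + 1} →ₗ[B] N)

/-- A map from `(X, Y)_φ` to `(N, N)_id` has the form `(u, u ∘ φ)`, with `u : X → N` arbitrary. -/
theorem homExtends_map_idTriple {a : X →ₗ[B] X'} {b : Y →ₗ[B] Y'} (h : a.comp φ = φ'.comp b) :
    HomExtends (map a b h) (idTriple B N) ↔ HomExtends a N := by
  constructor
  · intro H u
    obtain ⟨v, hv⟩ := H (map u (u.comp φ) rfl)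
    obtain ⟨a', b', h', rfl⟩ := exists_eq_map v
    rw [map_comp_map, map_eq_map_iff] at hv
    exact ⟨a', hv.1⟩
  · intro H u
    obtain ⟨a', b', h', rfl⟩ := exists_eq_map u
    obtain ⟨a'', rfl⟩ := H a'
    refine ⟨map a'' (a''.comp φ') rfl, ?_⟩
    rw [map_comp_map, map_eq_map_iff]
    refine ⟨rfl, ?_⟩
    rw [LinearMap.comp_assoc, ← h]
    exact h'

theorem homExtends_map_bottomTriple {a : X →ₗ[B] X'} {b : Y →ₗ[B] Y'}
    (h : a.comp φ = φ'.comp b) :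
    HomExtends (map a b h) (bottomTriple B N) ↔ HomExtends b N := by
  constructor
  · intro H u
    obtain ⟨v, hv⟩ := H (map 0 u (Subsingleton.elim _ _))
    obtain ⟨a', b', h', rfl⟩ := exists_eq_map v
    rw [map_comp_map, map_eq_map_iff] at hv
    exact ⟨b', hv.2⟩
  · intro H u
    obtain ⟨a', b', h', rfl⟩ := exists_eq_map u
    obtain ⟨b'', rfl⟩ := H b'
    refine ⟨map 0 b'' (Subsingleton.elim _ _), ?_⟩
    rw [map_comp_map, map_eq_map_iff]
    exact ⟨Subsingleton.elim _ _, rfl⟩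

/-- Every triple is the cokernel of a monomorphism of triples `κ → (P ⊕ Q, Q)` with `P` and `Q`
projective. -/
theorem exists_projective_cover (φ : Y →ₗ[B] X) :
    ∃ (K₁ K₂ P Q : ModuleCat.{u} B) (κ : K₂ →ₗ[B] K₁) (a : K₁ →ₗ[B] P × Q) (b : K₂ →ₗ[B] Q)
      (c : P × Q →ₗ[B] X) (d : Q →ₗ[B] Y), Module.Projective B P ∧ Module.Projective B Q ∧
      a.comp κ = (LinearMap.inr B P Q).comp b ∧ c.comp (LinearMap.inr B P Q) = φ.comp d ∧
      Function.Injective a ∧ Function.Injective b ∧ Function.Surjective c ∧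
      Function.Surjective d ∧ Function.Exact a c ∧ Function.Exact b d := by
  let p : (X →₀ B) →ₗ[B] X := Finsupp.linearCombination B id
  let q : (Y →₀ B) →ₗ[B] Y := Finsupp.linearCombination B id
  have hp : Function.Surjective p := Finsupp.linearCombination_id_surjective B X
  have hq : Function.Surjective q := Finsupp.linearCombination_id_surjective B Y
  -- The first summand makes `c` onto; the second makes the square with `φ` commute.
  let c : (X →₀ B) × (Y →₀ B) →ₗ[B] X := p.coprod (φ.comp q)
  let κ : LinearMap.ker q →ₗ[B] LinearMap.ker c :=
    (LinearMap.inr B (X →₀ B) (Y →₀ B)).restrict fun v hv => by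
      simp only [LinearMap.mem_ker] at hv ⊢
      simp [c, hv]
  refine ⟨ModuleCat.of B (LinearMap.ker c), ModuleCat.of B (LinearMap.ker q),
    ModuleCat.of B (X →₀ B), ModuleCat.of B (Y →₀ B), κ, (LinearMap.ker c).subtype,
    (LinearMap.ker q).subtype, c, q, inferInstanceAs (Module.Projective B (X →₀ B)),
    inferInstanceAs (Module.Projective B (Y →₀ B)), rfl, ?_, Subtype.val_injective,
    Subtype.val_injective, ?_, hq, LinearMap.exact_subtype_ker_map c,
    LinearMap.exact_subtype_ker_map q⟩
  · exact LinearMap.coprod_inr _ _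
  · intro x
    obtain ⟨v, rfl⟩ := hp x
    exact ⟨(v, 0), by simp [c]⟩

/-- A syzygy of `(X, Y)_φ` is a triple whose top is a syzygy of `X`. Its structure map differs from
`φ`, so the shifting runs over all triples at once. -/
theorem extZero_idTriple_iff (φ : Y →ₗ[B] X) (n : ℕ) (hn : 1 ≤ n) :
    ExtZero (T2 B) (Triple φ) (idTriple B N) n ↔ ExtZero B X N n := by
  refine extZero_iff_of_syzygies
    (ι := (X : ModuleCat.{u} B) × (Y : ModuleCat.{u} B) × (Y →ₗ[B] X))
    (fun i => ModuleCat.of (T2 B) (Triple i.2.2)) (fun i => i.1) ?_ n hn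
    ⟨ModuleCat.of B X, ModuleCat.of B Y, φ⟩
  rintro ⟨X, Y, φ⟩
  obtain ⟨K₁, K₂, P, Q, κ, a, b, c, d, hP, hQ, h, h', ha, hb, hc, hd, hac, hbd⟩ :=
    exists_projective_cover φ
  exact ⟨⟨K₁, K₂, κ⟩, ModuleCat.of _ (Triple (LinearMap.inr B P Q)), ModuleCat.of _ (P × Q),
    map a b h, map c d h', a, c, projective_triple_inr P Q,
    inferInstanceAs (Module.Projective B (P × Q)), map_injective h ha hb, map_surjective h' hc hd,
    map_exact h h' hac hbd, ha, hc, hac, homExtends_map_idTriple h⟩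

theorem extZero_bottomTriple_iff (φ : Y →ₗ[B] X) (n : ℕ) (hn : 1 ≤ n) :
    ExtZero (T2 B) (Triple φ) (bottomTriple B N) n ↔ ExtZero B Y N n := by
  refine extZero_iff_of_syzygies
    (ι := (X : ModuleCat.{u} B) × (Y : ModuleCat.{u} B) × (Y →ₗ[B] X))
    (fun i => ModuleCat.of (T2 B) (Triple i.2.2)) (fun i => i.2.1) ?_ n hn
    ⟨ModuleCat.of B X, ModuleCat.of B Y, φ⟩
  rintro ⟨X, Y, φ⟩
  obtain ⟨K₁, K₂, P, Q, κ, a, b, c, d, hP, hQ, h, h', ha, hb, hc, hd, hac, hbd⟩ :=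
    exists_projective_cover φ
  exact ⟨⟨K₁, K₂, κ⟩, ModuleCat.of _ (Triple (LinearMap.inr B P Q)), Q,
    map a b h, map c d h', b, d, projective_triple_inr P Q, hQ,
    map_injective h ha hb, map_surjective h' hc hd,
    map_exact h h' hac hbd, hb, hd, hbd, homExtends_map_bottomTriple h⟩

/-- Apply `Hom((X, Y)_φ, -)` to `0 → (N, 0) → (N, N) → (0, N) → 0`. A map to `(0, N)` is some `u : Y
→ N`, and lifting it to `(N, N)` means extending `u` along `φ`. -/
theorem extVanishes_idTriple_prod_topTriple_iff (φ : Y →ₗ[B] X) :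
    ExtVanishes (T2 B) (Triple φ) (idTriple B N × topTriple B N) ↔
      ExtVanishes B X N ∧ ExtVanishes B Y N ∧ HomExtends φ N := by
  have h₁ : ExtVanishes (T2 B) (Triple φ) (idTriple B N) ↔
      ExtVanishes B X N := forall₂_congr fun n hn => extZero_idTriple_iff φ n hn
  have h₂ : ExtVanishes (T2 B) (Triple φ) (bottomTriple B N) ↔ ExtVanishes B Y N :=
    forall₂_congr fun n hn => extZero_bottomTriple_iff φ n hn
  rw [extVanishes_prod_iff, h₁]
  refine and_congr_right fun hX => ?_
  have hi : (LinearMap.id : N →ₗ[B] N).comp (0 : PUnit.{u + 1} →ₗ[B] N) =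
    (LinearMap.id : N →ₗ[B] N).comp 0 := rfl
  have hp : (0 : N →ₗ[B] PUnit.{u + 1}).comp LinearMap.id =
    (0 : N →ₗ[B] PUnit.{u + 1}).comp LinearMap.id := rfl
  have hlift : HomLifts (Triple φ) (map (0 : N →ₗ[B] PUnit.{u + 1}) LinearMap.id hp) ↔
      HomExtends φ N := by
    constructor
    · intro H u
      obtain ⟨v, hv⟩ := H (map 0 u (Subsingleton.elim _ _))
      obtain ⟨a, b, h, rfl⟩ := exists_eq_map v
      rw [map_comp_map, map_eq_map_iff] at hv
      exact ⟨a, h.trans hv.2⟩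
    · intro H u
      obtain ⟨a, b, h, rfl⟩ := exists_eq_map u
      obtain ⟨v, rfl⟩ := H b
      refine ⟨map v (v.comp φ) rfl, ?_⟩
      rw [map_comp_map, map_eq_map_iff]
      exact ⟨Subsingleton.elim _ _, rfl⟩
  rw [extVanishes_sub_iff (map_injective hi Function.injective_id
      (Function.injective_of_subsingleton _))
    (map_surjective hp (fun x => ⟨0, Subsingleton.elim _ _⟩) Function.surjective_id)
    (map_exact hi hp ?_ ?_) (h₁.2 hX), h₂, hlift, and_comm]
  · exact fun x => ⟨fun _ => ⟨x, rfl⟩, fun _ => Subsingleton.elim _ _⟩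
  · exact fun x => ⟨fun hx => ⟨0, (show (0 : N) = x from hx.symm)⟩, fun ⟨_, hx⟩ => hx.symm⟩

end TripleExt

end T2Modules

noncomputable section

namespace T2Modules

/-! ### The regular module and the dual of a triple -/

section TripleDual

variable {A : Type u} [Ring A] {X Y : Type u} [AddCommGroup X] [Module A X]
  [AddCommGroup Y] [Module A Y]

namespace T2

variable (A) in
/-- `T₂(A)ᵐᵒᵖ ≃ T₂(Aᵐᵒᵖ)`, the reflection in the antidiagonal. -/
def opEquiv : (T2 A)ᵐᵒᵖ ≃+* T2 Aᵐᵒᵖ where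
  toFun m := mk (op (m.unop.1 1 1)) (op (m.unop.1 0 1)) (op (m.unop.1 0 0))
  invFun m := op (mk (m.1 1 1).unop (m.1 0 1).unop (m.1 0 0).unop)
  left_inv m := unop_injective (mk_entries m.unop)
  right_inv m := mk_entries m
  map_add' m n := by
    rw [mk_add_mk]
    rfl
  map_mul' m n := by
    induction m with | h m =>
    induction n with | h n =>
    rw [mk_mul_mk, ← op_mul, unop_op, ← mk_entries m, ← mk_entries n, mk_mul_mk]
    simp [add_comm]

variable (A) in
/-- The decomposition of `T₂(A)` into its columns. -/
def columnsEquiv : T2 A ≃ₗ[T2 A] idTriple A A × topTriple A A where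
  toFun m := (Triple.mk _ (m.1 0 1) (m.1 1 1), Triple.mk _ (m.1 0 0) PUnit.unit)
  invFun z := mk z.2.1 z.1.1 z.1.2
  left_inv m := mk_entries m
  right_inv _ := rfl
  map_add' _ _ := rfl
  map_smul' m n := by
    rw [smul_eq_mul, ← mk_entries m, ← mk_entries n, mk_mul_mk]
    simp [Prod.smul_def, Triple.smul_mk]

variable (A) in
/-- The decomposition of `T₂(A)` into its rows. -/
def rowsEquiv : T2 A ≃+ idTriple Aᵐᵒᵖ A × topTriple Aᵐᵒᵖ A where
  -- Antidiagonal reflection turns the row `(a b)` into the column with `b` above `a`.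
  toFun m := (Triple.mk _ (m.1 0 1) (m.1 0 0), Triple.mk _ (m.1 1 1) PUnit.unit)
  invFun z := mk z.1.2 z.1.1 z.2.1
  left_inv m := mk_entries m
  right_inv _ := rfl
  map_add' _ _ := rfl

theorem rowsEquiv_mk (a b d : A) :
    rowsEquiv A (mk a b d) = (Triple.mk _ b a, Triple.mk _ d PUnit.unit) := rfl

theorem opEquiv_op_mk (a b d : A) : opEquiv A (op (mk a b d)) = mk (op d) (op b) (op a) := rfl

/-- The right regular module of `T₂(A)` thus has the same shape over `T₂(Aᵐᵒᵖ)` as the left one, so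
the left-handed `Ext` criterion covers both sides. -/
theorem rowsEquiv_smul (m : (T2 A)ᵐᵒᵖ) (n : T2 A) :
    rowsEquiv A (m • n) = opEquiv A m • rowsEquiv A n := by
  induction m with | h m =>
  rw [op_smul_eq_mul, ← mk_entries m, ← mk_entries n, mk_mul_mk]
  simp only [rowsEquiv_mk, opEquiv_op_mk, Prod.smul_mk, Triple.t2mk_smul_mk]
  simp [add_comm]

end T2

variable (φ : Y →ₗ[A] X)

/-- The functional `(x, y) ↦ (g(π(x)), α(x); 0, α(φ(y)))` on a triple. -/
def functionalMk (α : LDual A X) (g : LDual A (Coker φ)) : LDual (T2 A) (Triple φ) where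
  toFun z := T2.mk (g (proj φ z.1)) (α z.1) (α (φ z.2))
  map_add' z w := by simp [T2.mk_add_mk]
  map_smul' m z := by
    have h : (Submodule.Quotient.mk (φ z.2) : Coker φ) = 0 :=
      (Submodule.Quotient.mk_eq_zero _).2 (LinearMap.mem_range_self φ _)
    rw [smul_eq_mul, RingHom.id_apply]
    conv_rhs => rw [← T2.mk_entries m, T2.mk_mul_mk]
    simp [h]

theorem functionalMk_mk (α : LDual A X) (g : LDual A (Coker φ)) (x : X) (y : Y) :
    functionalMk φ α g (Triple.mk φ x y) = T2.mk (g (proj φ x)) (α x) (α (φ y)) := rfl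

variable {φ}

theorem functional_mk_smul (f : LDual (T2 A) (Triple φ)) (a b d : A) (x : X) (y : Y) :
    f (Triple.mk φ (a • x + b • φ y) (d • y)) =
      T2.mk (a * (f (Triple.mk φ x y)).1 0 0)
        (a * (f (Triple.mk φ x y)).1 0 1 + b * (f (Triple.mk φ x y)).1 1 1)
        (d * (f (Triple.mk φ x y)).1 1 1) := by
  rw [← T2.mk_mul_mk, T2.mk_entries]
  exact f.map_smul (T2.mk a b d) (Triple.mk φ x y)

theorem exists_eq_functionalMk (f : LDual (T2 A) (Triple φ)) :
    ∃ α g, f = functionalMk φ α g := by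
  -- Linearity of `f` at each matrix unit. Here `h₄` lets the top left entry descend to `Coker φ`,
  -- and `h₅` expresses the bottom right entry through `α`.
  have h₁ (x : X) : (f (Triple.mk φ x 0)).1 1 1 = 0 := by
    simpa using congrArg (fun m => m.1 1 1) (functional_mk_smul f 1 0 0 x 0)
  have h₂ (y : Y) : (f (Triple.mk φ 0 y)).1 0 0 = 0 := by
    simpa using congrArg (fun m => m.1 0 0) (functional_mk_smul f 0 0 1 0 y)
  have h₃ (y : Y) : (f (Triple.mk φ 0 y)).1 0 1 = 0 := by
    simpa using congrArg (fun m => m.1 0 1) (functional_mk_smul f 0 0 1 0 y)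
  have h₄ (y : Y) : (f (Triple.mk φ (φ y) 0)).1 0 0 = 0 := by
    simpa using congrArg (fun m => m.1 0 0) (functional_mk_smul f 0 1 0 0 y)
  have h₅ (y : Y) : (f (Triple.mk φ (φ y) 0)).1 0 1 = (f (Triple.mk φ 0 y)).1 1 1 := by
    simpa using congrArg (fun m => m.1 0 1) (functional_mk_smul f 0 1 0 0 y)
  have hadd (x x' : X) : f (Triple.mk φ (x + x') 0) = f (Triple.mk φ x 0) + f (Triple.mk φ x' 0) := by
    rw [← map_add, Triple.mk_add_mk, add_zero]
  let α : LDual A X :=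
    { toFun := fun x => (f (Triple.mk φ x 0)).1 0 1
      map_add' := fun x x' => by rw [hadd]; rfl
      map_smul' := fun a x => by
        simpa using congrArg (fun m => m.1 0 1) (functional_mk_smul f a 0 0 x 0) }
  let γ : X →ₗ[A] A :=
    { toFun := fun x => (f (Triple.mk φ x 0)).1 0 0
      map_add' := fun x x' => by rw [hadd]; rfl
      map_smul' := fun a x => by
        simpa using congrArg (fun m => m.1 0 0) (functional_mk_smul f a 0 0 x 0) }
  refine ⟨α, (LinearMap.range φ).liftQ γ ?_, LinearMap.ext ?_⟩
  · rintro _ ⟨y, rfl⟩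
    exact h₄ y
  · rintro ⟨x, y⟩
    have e : f (Triple.mk φ x y) = f (Triple.mk φ x 0) + f (Triple.mk φ 0 y) := by
      rw [← map_add, Triple.mk_add_mk, add_zero, zero_add]
    change f (Triple.mk φ x y) = T2.mk (γ x) (α x) (α (φ y))
    rw [e]
    refine T2.ext_entries ?_ ?_ ?_
    · change _ + (f (Triple.mk φ 0 y)).1 0 0 = _
      rw [h₂, add_zero]; rfl
    · change _ + (f (Triple.mk φ 0 y)).1 0 1 = _
      rw [h₃, add_zero]; rfl
    · change (f (Triple.mk φ x 0)).1 1 1 + _ = _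
      rw [h₁, zero_add]; exact (h₅ y).symm

theorem functionalMk_inj {α α' : LDual A X} {g g' : LDual A (Coker φ)} :
    functionalMk φ α g = functionalMk φ α' g' ↔ α = α' ∧ g = g' := by
  constructor
  · intro h
    have h (x : X) := LinearMap.congr_fun h (Triple.mk φ x 0)
    simp only [functionalMk_mk] at h
    refine ⟨LinearMap.ext fun x => congrArg (fun m => m.1 0 1) (h x), LinearMap.ext fun z => ?_⟩
    obtain ⟨x, rfl⟩ := (LinearMap.range φ).mkQ_surjective z
    exact congrArg (fun m => m.1 0 0) (h x)
  · rintro ⟨rfl, rfl⟩; rfl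

/-- This is the action of the reflected matrix `(d b; 0 a)` on the column of `α` over `g` in the
triple of `π^*`. -/
theorem op_smul_functionalMk (a b d : A) (α : LDual A X) (g : LDual A (Coker φ)) :
    op (T2.mk a b d) • functionalMk φ α g =
      functionalMk φ (op d • α + op b • lDualMap (proj φ) g) (op a • g) := by
  refine LinearMap.ext fun z => ?_
  change T2.mk _ _ _ * T2.mk a b d = T2.mk _ _ _
  have h : (proj φ) (φ z.2) = 0 :=
      (Submodule.Quotient.mk_eq_zero _).2 (LinearMap.mem_range_self φ _)
  rw [T2.mk_mul_mk]
  simp [lDualMap, h, add_comm]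

variable (φ) in
/-- The dual of a triple is the triple of `π^*`, over the opposite ring. -/
def dualEquiv : Triple (lDualMap (proj φ)) ≃+ LDual (T2 A) (Triple φ) :=
  AddEquiv.ofBijective
    ({ toFun := fun z => functionalMk φ z.1 z.2
       map_zero' := LinearMap.ext fun z => T2.ext_entries rfl rfl rfl
       map_add' := fun z w => LinearMap.ext fun v => T2.ext_entries rfl rfl rfl } :
      Triple (lDualMap (proj φ)) →+ LDual (T2 A) (Triple φ))
    ⟨fun z w h => Prod.ext (functionalMk_inj.1 h).1 (functionalMk_inj.1 h).2, fun f => by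
      obtain ⟨α, g, rfl⟩ := exists_eq_functionalMk f
      exact ⟨Triple.mk _ α g, rfl⟩⟩

theorem dualEquiv_symm_functionalMk (α : LDual A X) (g : LDual A (Coker φ)) :
    (dualEquiv φ).symm (functionalMk φ α g) = Triple.mk _ α g :=
  (dualEquiv φ).symm_apply_apply (Triple.mk _ α g)

theorem dualEquiv_symm_smul (m : (T2 A)ᵐᵒᵖ) (f : LDual (T2 A) (Triple φ)) :
    (dualEquiv φ).symm (m • f) = T2.opEquiv A m • (dualEquiv φ).symm f := by
  obtain ⟨α, g, rfl⟩ := exists_eq_functionalMk f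
  induction m with | h m =>
  conv_lhs => rw [← T2.mk_entries m, op_smul_functionalMk]
  rw [dualEquiv_symm_functionalMk, dualEquiv_symm_functionalMk, Triple.smul_mk]
  rfl

variable (φ)

/-- `HomExtends φ A` unfolds to surjectivity of `φ^*`. -/
theorem semiGP_triple_iff :
    SemiGP (T2 A) (Triple φ) ↔
      SemiGP A X ∧ SemiGP A Y ∧ Function.Surjective (lDualMap φ) :=
  (extVanishes_congr_right (T2.columnsEquiv A)).trans
    (extVanishes_idTriple_prod_topTriple_iff φ)

theorem rSemiGP_dual_triple_iff :
    RSemiGP (T2 A) (LDual (T2 A) (Triple φ)) ↔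
      RSemiGP A (LDual A X) ∧ RSemiGP A (LDual A (Coker φ)) ∧
        HomExtends (lDualMap (proj φ)) A :=
  (extVanishes_iff_of_ringEquiv (T2.opEquiv A) (dualEquiv φ).symm dualEquiv_symm_smul
    (T2.rowsEquiv A) T2.rowsEquiv_smul).trans
    (extVanishes_idTriple_prod_topTriple_iff (lDualMap (proj φ)))

theorem lDualMap_proj_injective : Function.Injective (lDualMap (proj φ)) := fun g g' h =>
  LinearMap.ext fun z => by
    obtain ⟨x, rfl⟩ := (LinearMap.range φ).mkQ_surjective z
    exact LinearMap.congr_fun h x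

theorem lDualMap_exact : Function.Exact (lDualMap (proj φ)) (lDualMap φ) := by
  intro α
  constructor
  · intro h
    refine ⟨(LinearMap.range φ).liftQ α ?_, LinearMap.ext fun x => rfl⟩
    rintro _ ⟨y, rfl⟩
    exact LinearMap.congr_fun h y
  · rintro ⟨g, rfl⟩
    refine LinearMap.ext fun y => ?_
    change g ((LinearMap.range φ).mkQ (φ y)) = 0
    rw [Submodule.mkQ_apply, (Submodule.Quotient.mk_eq_zero _).2 (LinearMap.mem_range_self φ y),
      map_zero]

/-- The conditions on the dual involve extension along `π^*` rather than `Y^*`. With `φ^*` onto, `0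
→ (Coker φ)^* → X^* → Y^* → 0` is exact and trades one for the other. -/
theorem doubleSemiGP_triple_iff :
    DoubleSemiGP (T2 A) (Triple φ) ↔ Function.Surjective (lDualMap φ) ∧ DoubleSemiGP A X ∧
      DoubleSemiGP A Y ∧ RSemiGP A (LDual A (Coker φ)) := by
  have key (hs : Function.Surjective (lDualMap φ)) (hX : RSemiGP A (LDual A X)) :
      RSemiGP A (LDual A Y) ↔ HomExtends (lDualMap (proj φ)) A ∧ RSemiGP A (LDual A (Coker φ)) :=
    extVanishes_quotient_iff (lDualMap_proj_injective φ) hs (lDualMap_exact φ) hX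
  simp only [DoubleSemiGP, semiGP_triple_iff, rSemiGP_dual_triple_iff]
  constructor
  · rintro ⟨⟨hX, hY, hs⟩, hX', hC, he⟩
    exact ⟨hs, ⟨hX, hX'⟩, ⟨hY, (key hs hX').2 ⟨he, hC⟩⟩, hC⟩
  · rintro ⟨hs, ⟨hX, hX'⟩, ⟨hY, hY'⟩, hC⟩
    exact ⟨⟨hX, hY, hs⟩, hX', hC, ((key hs hX').1 hY').1⟩

end TripleDual

/-! ### The double dual and the canonical map -/

section DoubleDual

variable {A : Type u} [Ring A] {X Y : Type u} [AddCommGroup X] [Module A X]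
  [AddCommGroup Y] [Module A Y] (φ : Y →ₗ[A] X)

theorem pMap_lDualMap_proj (g : LDual A (Coker φ)) : pMap φ (lDualMap (proj φ) g) = 0 :=
  (Submodule.Quotient.mk_eq_zero _).2 (LinearMap.mem_range_self _ g)

/-- The functional on `(X, Y)_φ^*` given by `b ∈ X^{**}` and `c ∈ (Coker π^*)^*`. -/
def biFunctional (b : RDual A (LDual A X)) (c : RDual A (CokerPiStar φ)) :
    RDual (T2 A) (LDual (T2 A) (Triple φ)) where
  toFun f := T2.mk (b (lDualMap (proj φ) ((dualEquiv φ).symm f).2)) (b ((dualEquiv φ).symm f).1)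
    (c (pMap φ ((dualEquiv φ).symm f).1))
  map_add' f f' := by
    rw [T2.mk_add_mk, map_add, Triple.fst_add, Triple.snd_add]
    simp only [map_add]
  map_smul' m f := by
    induction m with | h m =>
    obtain ⟨α, g, rfl⟩ := exists_eq_functionalMk f
    rw [← T2.mk_entries m, op_smul_functionalMk, RingHom.id_apply, op_smul_eq_mul, T2.mk_mul_mk]
    simp only [dualEquiv_symm_functionalMk, Triple.fst_mk, Triple.snd_mk, map_add, map_smul,
      pMap_lDualMap_proj, smul_zero, add_zero, op_smul_eq_mul]
    rw [add_comm]

theorem biFunctional_functionalMk (b : RDual A (LDual A X)) (c : RDual A (CokerPiStar φ))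
    (α : LDual A X) (g : LDual A (Coker φ)) :
    biFunctional φ b c (functionalMk φ α g) =
      T2.mk (b (lDualMap (proj φ) g)) (b α) (c (pMap φ α)) := by
  change T2.mk _ _ _ = _
  rw [dualEquiv_symm_functionalMk]
  rfl

/-- The map from the triple of `p^*` to the double dual of a triple. -/
def biFunctionalMap : Triple (rDualMap (pMap φ)) →ₗ[T2 A]
    RDual (T2 A) (LDual (T2 A) (Triple φ)) where
  toFun z := biFunctional φ z.1 z.2
  map_add' z w := by
    refine LinearMap.ext fun f => ?_
    exact (T2.mk_add_mk _ _ _ _ _ _).symm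
  map_smul' m z := by
    refine LinearMap.ext fun f => ?_
    obtain ⟨α, g, rfl⟩ := exists_eq_functionalMk f
    change biFunctional φ (m • z).1 (m • z).2 _ = m * biFunctional φ z.1 z.2 _
    rw [Triple.fst_smul, Triple.snd_smul, biFunctional_functionalMk, biFunctional_functionalMk]
    conv_rhs => rw [← T2.mk_entries m, T2.mk_mul_mk]
    have h : z.2 (pMap φ (lDualMap (proj φ) g)) = 0 := by rw [pMap_lDualMap_proj, map_zero]
    have h' (β : LDual A X) : rDualMap (pMap φ) z.2 β = z.2 (pMap φ β) := rfl
    simp only [LinearMap.add_apply, LinearMap.smul_apply, smul_eq_mul, h', h, mul_zero, add_zero]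

variable {φ} in
theorem biFunctional_entries_smul (H : RDual (T2 A) (LDual (T2 A) (Triple φ))) (a b d : A)
    (α : LDual A X) (g : LDual A (Coker φ)) :
    H (functionalMk φ (op d • α + op b • lDualMap (proj φ) g) (op a • g)) =
      T2.mk ((H (functionalMk φ α g)).1 0 0 * a)
        ((H (functionalMk φ α g)).1 0 0 * b + (H (functionalMk φ α g)).1 0 1 * d)
        ((H (functionalMk φ α g)).1 1 1 * d) := by
  rw [← T2.mk_mul_mk, T2.mk_entries, ← op_smul_functionalMk]
  exact H.map_smul _ _

variable {φ} in
theorem exists_eq_biFunctional (H : RDual (T2 A) (LDual (T2 A) (Triple φ))) :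
    ∃ b c, H = biFunctional φ b c := by
  have hadd (α α' : LDual A X) (g g' : LDual A (Coker φ)) :
      H (functionalMk φ (α + α') (g + g')) =
        H (functionalMk φ α g) + H (functionalMk φ α' g') := by
    rw [← map_add]
    exact congrArg H (map_add (dualEquiv φ) (Triple.mk _ α g) (Triple.mk _ α' g'))
  -- Matrix units again: `h₄` makes the bottom right entry descend to `Coker π^*`, and `h₅` shows
  -- that the top left entry is `b` composed with `π^*`.
  have h₁ (α : LDual A X) : (H (functionalMk φ α 0)).1 0 0 = 0 := by
    simpa using congrArg (fun m => m.1 0 0) (biFunctional_entries_smul H 0 0 1 α 0)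
  have h₂ (g : LDual A (Coker φ)) : (H (functionalMk φ 0 g)).1 0 1 = 0 := by
    simpa using congrArg (fun m => m.1 0 1) (biFunctional_entries_smul H 1 0 0 0 g)
  have h₃ (g : LDual A (Coker φ)) : (H (functionalMk φ 0 g)).1 1 1 = 0 := by
    simpa using congrArg (fun m => m.1 1 1) (biFunctional_entries_smul H 1 0 0 0 g)
  have h₄ (g : LDual A (Coker φ)) : (H (functionalMk φ (lDualMap (proj φ) g) 0)).1 1 1 = 0 := by
    simpa using congrArg (fun m => m.1 1 1) (biFunctional_entries_smul H 0 1 0 0 g)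
  have h₅ (g : LDual A (Coker φ)) : (H (functionalMk φ (lDualMap (proj φ) g) 0)).1 0 1 =
      (H (functionalMk φ 0 g)).1 0 0 := by
    simpa using congrArg (fun m => m.1 0 1) (biFunctional_entries_smul H 0 1 0 0 g)
  let b : RDual A (LDual A X) :=
    { toFun := fun α => (H (functionalMk φ α 0)).1 0 1
      map_add' := fun α α' => by
        rw [← add_zero (0 : LDual A (Coker φ)), hadd]
        simp
      map_smul' := fun a α => by
        simpa using congrArg (fun m => m.1 0 1) (biFunctional_entries_smul H 0 0 a.unop α 0) }
  let γ : LDual A X →ₗ[Aᵐᵒᵖ] A :=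
    { toFun := fun α => (H (functionalMk φ α 0)).1 1 1
      map_add' := fun α α' => by
        rw [← add_zero (0 : LDual A (Coker φ)), hadd]
        simp
      map_smul' := fun a α => by
        simpa using congrArg (fun m => m.1 1 1) (biFunctional_entries_smul H 0 0 a.unop α 0) }
  refine ⟨b, (LinearMap.range (lDualMap (proj φ))).liftQ γ ?_, LinearMap.ext fun f => ?_⟩
  · rintro _ ⟨g, rfl⟩
    exact h₄ g
  · obtain ⟨α, g, rfl⟩ := exists_eq_functionalMk f
    rw [biFunctional_functionalMk]
    change _ = T2.mk (H (functionalMk φ (lDualMap (proj φ) g) 0) |>.1 0 1)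
      (H (functionalMk φ α 0) |>.1 0 1) (H (functionalMk φ α 0) |>.1 1 1)
    have e := hadd α 0 0 g
    rw [add_zero, zero_add] at e
    have e₁ : (H (functionalMk φ α g)).1 0 0 =
        (H (functionalMk φ α 0)).1 0 0 + (H (functionalMk φ 0 g)).1 0 0 :=
      congrArg (fun m : T2 A => m.1 0 0) e
    have e₂ : (H (functionalMk φ α g)).1 0 1 =
        (H (functionalMk φ α 0)).1 0 1 + (H (functionalMk φ 0 g)).1 0 1 :=
      congrArg (fun m : T2 A => m.1 0 1) e
    have e₃ : (H (functionalMk φ α g)).1 1 1 =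
        (H (functionalMk φ α 0)).1 1 1 + (H (functionalMk φ 0 g)).1 1 1 :=
      congrArg (fun m : T2 A => m.1 1 1) e
    rw [h₅]
    exact T2.ext_entries (by rw [e₁, h₁, zero_add]; rfl) (by rw [e₂, h₂, add_zero]; rfl)
      (by rw [e₃, h₃, add_zero]; rfl)

theorem biFunctionalMap_bijective : Function.Bijective (biFunctionalMap φ) := by
  constructor
  · rintro ⟨b, c⟩ ⟨b', c'⟩ h
    have h (α : LDual A X) := LinearMap.congr_fun
      (show biFunctional φ b c = biFunctional φ b' c' from h) (functionalMk φ α 0)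
    simp only [biFunctional_functionalMk] at h
    refine Prod.ext (LinearMap.ext fun α => congrArg (fun m => m.1 0 1) (h α))
      (LinearMap.ext fun z => ?_)
    obtain ⟨α, rfl⟩ := (LinearMap.range (lDualMap (proj φ))).mkQ_surjective z
    exact congrArg (fun m => m.1 1 1) (h α)
  · intro H
    obtain ⟨b, c, rfl⟩ := exists_eq_biFunctional H
    exact ⟨Triple.mk _ b c, rfl⟩

/-- The double dual of a triple. -/
def doubleDualEquiv : Triple (rDualMap (pMap φ)) ≃ₗ[T2 A]
    RDual (T2 A) (LDual (T2 A) (Triple φ)) :=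
  LinearEquiv.ofBijective (biFunctionalMap φ) (biFunctionalMap_bijective φ)

theorem doubleDualEquiv_apply (b : RDual A (LDual A X)) (c : RDual A (CokerPiStar φ))
    (f : LDual (T2 A) (Triple φ)) (g : LDual A (Coker φ)) (α : LDual A X)
    (hf : ∀ (x : X) (y : Y), (f (Triple.mk φ x y) : Matrix (Fin 2) (Fin 2) A) =
      !![g (proj φ x), α x; 0, α (φ y)]) :
    (doubleDualEquiv φ (Triple.mk _ b c) f : Matrix (Fin 2) (Fin 2) A) =
      !![b (lDualMap (proj φ) g), b α; 0, c (pMap φ α)] := by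
  have : f = functionalMk φ α g := LinearMap.ext fun ⟨x, y⟩ => Subtype.ext (hf x y)
  subst this
  exact congrArg Subtype.val (biFunctional_functionalMk φ b c α g)

/-- The bottom right entries agree because `β(p(α)) = φ^*(α)`, whose value at `y` is `α(φ(y))`. -/
theorem canon_triple (x : X) (y : Y) :
    canon (T2 A) (Triple φ) (Triple.mk φ x y) =
      doubleDualEquiv φ (Triple.mk _ (canon A X x) (rDualMap (beta φ) (canon A Y y))) := by
  refine LinearMap.ext fun f => ?_
  obtain ⟨α, g, rfl⟩ := exists_eq_functionalMk f
  exact (biFunctional_functionalMk φ (canon A X x) (rDualMap (beta φ) (canon A Y y)) α g).symm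

theorem rDualMap_pMap_injective : Function.Injective (rDualMap (pMap φ)) := fun c c' h =>
  LinearMap.ext fun z => by
    obtain ⟨α, rfl⟩ := (LinearMap.range (lDualMap (proj φ))).mkQ_surjective z
    exact LinearMap.congr_fun h α

theorem beta_injective : Function.Injective (beta φ) := by
  refine (injective_iff_map_eq_zero _).2 fun z hz => ?_
  obtain ⟨α, rfl⟩ := (LinearMap.range (lDualMap (proj φ))).mkQ_surjective z
  obtain ⟨g, rfl⟩ := (lDualMap_exact φ α).1 hz
  exact pMap_lDualMap_proj φ g

variable {φ}

/-- `β` is always injective, as `ker φ^*` is the image of `π^*`, and it has the same image as `φ^*`.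
So here `β` is an isomorphism and `β^* φ_Y` behaves like `φ_Y`. -/
theorem rDualMap_beta_bijective (h : Function.Surjective (lDualMap φ)) :
    Function.Bijective (rDualMap (beta φ)) := by
  let e := LinearEquiv.ofBijective (beta φ) ⟨beta_injective φ, fun y => by
    obtain ⟨α, rfl⟩ := h y
    exact ⟨pMap φ α, rfl⟩⟩
  constructor
  · intro c c' hc
    refine LinearMap.ext fun y => ?_
    obtain ⟨z, rfl⟩ := e.surjective y
    exact LinearMap.congr_fun hc z
  · intro c
    refine ⟨c.comp (e.symm : LDual A Y →ₗ[Aᵐᵒᵖ] CokerPiStar φ), LinearMap.ext fun z => ?_⟩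
    exact congrArg c (e.symm_apply_apply z)

theorem canon_triple_eq_comp : ⇑(canon (T2 A) (Triple φ)) = doubleDualEquiv φ ∘
    Prod.map (canon A X) (rDualMap (beta φ) ∘ canon A Y) :=
  funext fun z => canon_triple φ z.1 z.2

theorem torsionless_triple_iff (h : Function.Surjective (lDualMap φ)) :
    Torsionless (T2 A) (Triple φ) ↔ Torsionless A X ∧ Torsionless A Y := by
  rw [Torsionless, canon_triple_eq_comp]
  refine (Function.Injective.of_comp_iff (doubleDualEquiv φ).injective _).trans ?_
  refine Prod.map_injective.trans (and_congr Iff.rfl ?_)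
  exact Function.Injective.of_comp_iff (rDualMap_beta_bijective h).1 _

theorem canon_triple_surjective_iff (h : Function.Surjective (lDualMap φ)) :
    Function.Surjective (canon (T2 A) (Triple φ)) ↔
      Function.Surjective (canon A X) ∧ Function.Surjective (canon A Y) := by
  rw [canon_triple_eq_comp]
  refine (Function.Surjective.of_comp_iff' (doubleDualEquiv φ).bijective _).trans ?_
  refine Prod.map_surjective.trans (and_congr Iff.rfl ?_)
  exact Function.Surjective.of_comp_iff' (rDualMap_beta_bijective h) _

/-- Functionals separate the points of `Y`, and each of them factors through `φ`. -/
theorem injective_of_torsionless (h : Function.Surjective (lDualMap φ)) (hY : Torsionless A Y) :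
    Function.Injective φ := by
  refine (injective_iff_map_eq_zero _).2 fun y hy => hY (LinearMap.ext fun f => ?_)
  obtain ⟨α, rfl⟩ := h f
  change α (φ y) = α (φ 0)
  rw [hy, map_zero φ]

theorem semiGP_coker_iff (h : Function.Injective φ) (hX : SemiGP A X) :
    SemiGP A (Coker φ) ↔ Function.Surjective (lDualMap φ) ∧ SemiGP A Y :=
  extVanishes_quotient_iff h (LinearMap.range φ).mkQ_surjective
    (LinearMap.exact_map_mkQ_range φ) hX

end DoubleDual

end T2Modules

end

theorem theorem1p5 {R : Type*} [CommRing R] [IsArtinianRing R]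
    {A : Type u} [Ring A] [Algebra R A] [Module.Finite R A]
    {X Y : Type u} [AddCommGroup X] [Module A X] [Module.Finite A X]
    [AddCommGroup Y] [Module A Y] [Module.Finite A Y] (φ : Y →ₗ[A] X) :
    -- the double dual and the canonical map
    (Function.Injective (T2Modules.rDualMap (T2Modules.pMap φ)) ∧
      ∃ h : T2Modules.Triple (T2Modules.rDualMap (T2Modules.pMap φ)) ≃ₗ[T2Modules.T2 A]
          T2Modules.RDual (T2Modules.T2 A)
            (T2Modules.LDual (T2Modules.T2 A) (T2Modules.Triple φ)),
        (∀ (b : T2Modules.RDual A (T2Modules.LDual A X))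
          (c : T2Modules.RDual A (T2Modules.CokerPiStar φ))
          (f : T2Modules.LDual (T2Modules.T2 A) (T2Modules.Triple φ))
          (g : T2Modules.LDual A (T2Modules.Coker φ)) (α : T2Modules.LDual A X),
          (∀ (x : X) (y : Y), (f (T2Modules.Triple.mk φ x y) : Matrix (Fin 2) (Fin 2) A) =
            !![g (T2Modules.proj φ x), α x; 0, α (φ y)]) →
          (h (T2Modules.Triple.mk _ b c) f : Matrix (Fin 2) (Fin 2) A) =
            !![b (T2Modules.lDualMap (T2Modules.proj φ) g), b α; 0, c (T2Modules.pMap φ α)]) ∧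
        ∀ (x : X) (y : Y),
          T2Modules.canon (T2Modules.T2 A) (T2Modules.Triple φ) (T2Modules.Triple.mk φ x y) =
            h (T2Modules.Triple.mk _ (T2Modules.canon A X x)
              (T2Modules.rDualMap (T2Modules.beta φ) (T2Modules.canon A Y y)))) ∧
    -- torsionless and double semi-Gorenstein-projective
    ((T2Modules.Torsionless (T2Modules.T2 A) (T2Modules.Triple φ) ∧
        T2Modules.DoubleSemiGP (T2Modules.T2 A) (T2Modules.Triple φ)) ↔
      (Function.Injective φ ∧
        T2Modules.DoubleSemiGP A X ∧ T2Modules.DoubleSemiGP A Y ∧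
        T2Modules.DoubleSemiGP A (T2Modules.Coker φ) ∧
        T2Modules.Torsionless A X ∧ T2Modules.Torsionless A Y)) ∧
    -- double semi-Gorenstein-projective with epimorphic canonical map
    ((T2Modules.DoubleSemiGP (T2Modules.T2 A) (T2Modules.Triple φ) ∧
        Function.Surjective (T2Modules.canon (T2Modules.T2 A) (T2Modules.Triple φ))) ↔
      (Function.Surjective (T2Modules.lDualMap φ) ∧
        T2Modules.DoubleSemiGP A X ∧ T2Modules.DoubleSemiGP A Y ∧
        T2Modules.RSemiGP A (T2Modules.LDual A (T2Modules.Coker φ)) ∧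
        Function.Surjective (T2Modules.canon A X) ∧
        Function.Surjective (T2Modules.canon A Y))) := by
  refine ⟨⟨T2Modules.rDualMap_pMap_injective φ, T2Modules.doubleDualEquiv φ,
    T2Modules.doubleDualEquiv_apply φ, T2Modules.canon_triple φ⟩, ?_, ?_⟩
  · rw [T2Modules.doubleSemiGP_triple_iff]
    constructor
    · rintro ⟨hT, hs, hX, hY, hC⟩
      obtain ⟨hTX, hTY⟩ := (T2Modules.torsionless_triple_iff hs).1 hT
      have hφ := T2Modules.injective_of_torsionless hs hTY
      exact ⟨hφ, hX, hY, ⟨(T2Modules.semiGP_coker_iff hφ hX.1).2 ⟨hs, hY.1⟩, hC⟩, hTX, hTY⟩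
    · rintro ⟨hφ, hX, hY, hC, hTX, hTY⟩
      -- Surjectivity of `φ^*` comes from `Ext¹(Coker φ, A) = 0`.
      have hs := ((T2Modules.semiGP_coker_iff hφ hX.1).1 hC.1).1
      exact ⟨(T2Modules.torsionless_triple_iff hs).2 ⟨hTX, hTY⟩, hs, hX, hY, hC.2⟩
  · rw [T2Modules.doubleSemiGP_triple_iff]
    constructor
    · rintro ⟨⟨hs, hX, hY, hC⟩, he⟩
      exact ⟨hs, hX, hY, hC, (T2Modules.canon_triple_surjective_iff hs).1 he⟩
    · rintro ⟨hs, hX, hY, hC, he⟩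
      exact ⟨⟨hs, hX, hY, hC⟩, (T2Modules.canon_triple_surjective_iff hs).2 he⟩
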